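/- Let $a<b$, let $m\ge 1$ be an integer, let $k\in L^2((a,b)^2)$ be a real kernel, and let $K:L^2(a,b)\to L^2(a,b)$, $(Kx)(s)=\int_a^b k(s,t)x(t)\,dt$. Suppose that the range of $K$ is contained in the Sobolev space $H^m(a,b)$; point values of $Kx$ are those of its representative that is continuous on $[a,b]$. Let $B\ge 0$. Then there are constants $\alpha_0>0$ and $C>0$, depending only on $a,b,m,k,B$, such that the following holds. Let $n\ge1$ and let $a\le s_1<\dots<s_n\le b$ be quasi-uniform with constant $B$, i.e. $h_{\max}/h_{\min}\le B$, where $h_{\max}=\max_{s\in[a,b]}\min_i|s-s_i|$ and $h_{\min}=\min_{i\ne j}|s_i-s_j|$ (with $h_{\min}=\infty$ if $n=1$). For $v\in\mathbb R^n$, or for the vector $v$ of values at $s_1,\dots,s_n$ of a function continuous on $[a,b]$, write $|v|_n=\bigl(\frac1n\sum_{i=1}^n v_i^2\bigr)^{1/2}$, and let $\|\cdot\|$ be the norm of $L^2(a,b)$. Let $e_1,\dots,e_n$ be independent square-integrable real random variables on a probability space with $\mathbb E[e_i]=0$ and $\operatorname{Var}[e_i]\le\sigma^2$. Let $x^\dagger\in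 L^2(a,b)$ be the best-approximate solution (the least-squares solution of minimal norm) of $Kx=y$ for some $y\in L^2(a,b)$, and let the data be $w_i=(Kx^\dagger)(s_i)+e_i$, $i=1,\dots,n$ (that is, $w_i=y(s_i)+e_i$ if $y$ lies in the range of $K$). Let $0<\alpha\le\alpha_0$. Then for every realization of the noise the functional $x\mapsto|Kx-w|_n^2+\alpha\|x\|^2$ has a unique minimizer $x_{n,\alpha}$ over $L^2(a,b)$, the two expectations below are finite, and $$\mathbb E\bigl[\|x_{n,\alpha}-x^\dagger\|^2\bigr]\le C\|x^\dagger\|^2+\frac{C\sigma^2}{n\,\alpha^{1+\frac1{2m}}},\qquad \mathbb E\bigl[|Kx_{n,\alpha}-Kx^\dagger|_n^2\bigr]\le C\alpha\|x^\dagger\|^2+\frac{C\sigma^2}{n\,\alpha^{\frac1{2m}}}.$$ -/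

import Mathlib

open MeasureTheory ProbabilityTheory Set
open scoped ENNReal NNReal

noncomputable section

namespace FredholmTikhonov

/-- Lebesgue measure on the open interval `(a, b)`. -/
abbrev lebesgue (a b : ℝ) : Measure ℝ := volume.restrict (Ioo a b)

/-- The real Hilbert space `L²(a, b)`. -/
abbrev L2 (a b : ℝ) : Type := Lp ℝ 2 (lebesgue a b)

/-- The space `L²((a, b)²)` of kernels. -/
abbrev L2Kernel (a b : ℝ) : Type := Lp ℝ 2 ((lebesgue a b).prod (lebesgue a b))

/-- For `k ∈ L²((a, b)²)` and `x ∈ L²(a, b)`, the function `s ↦ ∫ₐᵇ k(s, t) x(t) dt` is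
square integrable on `(a, b)`. -/
theorem memLp_integral_kernel {a b : ℝ} (k : L2Kernel a b) (x : L2 a b) :
    MemLp (fun s => ∫ t, k (s, t) * x t ∂(lebesgue a b)) 2 (lebesgue a b) := by
  have hk := Lp.memLp k
  have hx := Lp.memLp x
  have hm : AEStronglyMeasurable (fun p : ℝ × ℝ => k p * x p.2)
      ((lebesgue a b).prod (lebesgue a b)) :=
    hk.1.mul (hx.1.comp_snd)
  refine ⟨hm.integral_prod_right', ?_⟩
  rw [eLpNorm_lt_top_iff_lintegral_rpow_enorm_lt_top (by norm_num) (by norm_num)]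
  have hk2 := lintegral_rpow_enorm_lt_top_of_eLpNorm_lt_top (by norm_num) (by norm_num) hk.2
  have hx2 := lintegral_rpow_enorm_lt_top_of_eLpNorm_lt_top (by norm_num) (by norm_num) hx.2
  simp only [ENNReal.toReal_ofNat] at hk2 hx2 ⊢
  have hkm : AEMeasurable (fun p : ℝ × ℝ => ‖k p‖ₑ ^ (2 : ℝ))
      ((lebesgue a b).prod (lebesgue a b)) := hk.1.enorm.pow_const _
  rw [lintegral_prod _ hkm] at hk2
  refine lt_of_le_of_lt ?_ (ENNReal.mul_lt_top hk2 hx2)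
  rw [← lintegral_mul_const'' _ hkm.lintegral_prod_right']
  refine lintegral_mono_ae ?_
  filter_upwards [hk.1.prodMk_left] with s hs
  have h1 : ‖∫ t, k (s, t) * x t ∂(lebesgue a b)‖ₑ ≤
      ∫⁻ t, ‖k (s, t)‖ₑ * ‖x t‖ₑ ∂(lebesgue a b) :=
    (enorm_integral_le_lintegral_enorm _).trans_eq (by simp only [enorm_mul])
  have h2 := ENNReal.lintegral_mul_le_Lp_mul_Lq (lebesgue a b)
    (Real.HolderConjugate.two_two) hs.enorm hx.1.enorm
  calc _ ≤ _ := ENNReal.rpow_le_rpow (h1.trans h2) (by norm_num)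
    _ = _ := by
      rw [ENNReal.mul_rpow_of_nonneg _ _ (by norm_num), ← ENNReal.rpow_mul, ← ENNReal.rpow_mul]
      norm_num

/-- The integral operator `K : L²(a, b) → L²(a, b)`, `(K x)(s) = ∫ₐᵇ k(s, t) x(t) dt`. -/
def integralOp {a b : ℝ} (k : L2Kernel a b) (x : L2 a b) : L2 a b :=
  (memLp_integral_kernel k x).toLp

/-- `g` is the `j`-th weak derivative of `f` on `(a, b)`: for all `φ ∈ C_c^∞(a, b)`,
`∫ g φ = (-1)^j ∫ f φ^{(j)}`. -/
def HasWeakDeriv {a b : ℝ} (j : ℕ) (f g : L2 a b) : Prop :=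
  ∀ φ : ℝ → ℝ, ContDiff ℝ (⊤ : ℕ∞) φ → HasCompactSupport φ → tsupport φ ⊆ Ioo a b →
    ∫ t, g t * φ t ∂(lebesgue a b) = (-1) ^ j * ∫ t, f t * iteratedDeriv j φ t ∂(lebesgue a b)

/-- Membership in the Sobolev space `H^m(a, b)`: all weak derivatives of order at most `m`
exist in `L²(a, b)`. -/
def MemSobolev {a b : ℝ} (m : ℕ) (f : L2 a b) : Prop :=
  ∀ j ≤ m, ∃ g : L2 a b, HasWeakDeriv j f g

/-- The representative of `f ∈ L²(a, b)` that is continuous on `[a, b]`, for those classes that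
have one, such as all elements of `H^m(a, b)` with `m ≥ 1`; its values on `[a, b]` are determined
by `f` when `a < b`. It is `0` for classes without such a representative. -/
def continuousRep {a b : ℝ} (f : L2 a b) : ℝ → ℝ :=
  open Classical in
  if h : ∃ g : ℝ → ℝ, ContinuousOn g (Icc a b) ∧ f =ᵐ[lebesgue a b] g then h.choose else 0

/-- The values of `u` at the sampling points `s₁, …, sₙ`. -/
def sample {a b : ℝ} {n : ℕ} (s : Fin n → ℝ) (u : L2 a b) : Fin n → ℝ :=
  fun i => continuousRep u (s i)

/-- The empirical norm `|v|ₙ = ((1/n) ∑ᵢ vᵢ²)^{1/2}` of a vector of values at the sampling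
points. -/
def empNorm {n : ℕ} (v : Fin n → ℝ) : ℝ :=
  Real.sqrt ((1 / (n : ℝ)) * ∑ i, v i ^ 2)

/-- `h_max`, the maximum over `[a, b]` of the distance to the nearest sampling point. -/
def meshMax (a b : ℝ) {n : ℕ} (s : Fin n → ℝ) : ℝ≥0∞ :=
  ⨆ t ∈ Icc a b, ⨅ i, edist t (s i)

/-- `h_min`, the minimal distance of two different sampling points (`∞` for a single point). -/
def meshMin {n : ℕ} (s : Fin n → ℝ) : ℝ≥0∞ :=
  ⨅ (i : Fin n) (j : Fin n) (_ : i ≠ j), edist (s i) (s j)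

/-- `a ≤ s₁ < ⋯ < sₙ ≤ b` is a quasi-uniform partition of `[a, b]` with constant `B`. -/
structure IsQuasiUniform (a b : ℝ) (B : ℝ≥0) {n : ℕ} (s : Fin n → ℝ) : Prop where
  mem : ∀ i, s i ∈ Icc a b
  strictMono : StrictMono s
  ratio_le : meshMax a b s / meshMin s ≤ B

/-- `x` is a least-squares solution of `K x = y` in `L²(a, b)`. -/
def IsLeastSquaresSolution {a b : ℝ} (k : L2Kernel a b) (y x : L2 a b) : Prop :=
  ∀ z : L2 a b, ‖integralOp k x - y‖ ≤ ‖integralOp k z - y‖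

/-- `x` is the best-approximate solution of `K x = y`: the least-squares solution of minimal
norm. -/
def IsBestApproximateSolution {a b : ℝ} (k : L2Kernel a b) (y x : L2 a b) : Prop :=
  IsLeastSquaresSolution k y x ∧ ∀ z : L2 a b, IsLeastSquaresSolution k y z → ‖x‖ ≤ ‖z‖

/-- The discrete Tikhonov functional `|K x - w|ₙ² + α ‖x‖²`. -/
def tikhonov {a b : ℝ} (k : L2Kernel a b) {n : ℕ} (s w : Fin n → ℝ) (α : ℝ) (x : L2 a b) : ℝ :=
  empNorm (sample s (integralOp k x) - w) ^ 2 + α * ‖x‖ ^ 2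

/-- `x` is a regularized solution for the data `w`: a minimizer of the Tikhonov functional over
`L²(a, b)`. -/
def IsRegularizedSolution {a b : ℝ} (k : L2Kernel a b) {n : ℕ} (s w : Fin n → ℝ) (α : ℝ)
    (x : L2 a b) : Prop :=
  ∀ z : L2 a b, tikhonov k s w α x ≤ tikhonov k s w α z

end FredholmTikhonov

end

/-! Write `g i` for the Riesz representer of x ↦ (Kx)(sᵢ), T x = (⟪g i, x⟫)ᵢ for the sampled
operator with the empirical norm on ℝⁿ, and A = T*T. The minimizer is S(T*w) with S = (A + α)⁻¹, and
its error splits as c + ∑ eᵢ zᵢ, where c = -α S x† is the bias and zᵢ = S gᵢ / n. Since A ≥ 0, one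
has ‖c‖ ≤ ‖x†‖ and ⟪A c, c⟫ ≤ α‖x†‖². As the noise is centred and independent, no mixed terms
survive in the mean, and the variance is at most σ² ∑ ‖zᵢ‖² in L² and σ² ∑ ⟪A zᵢ, zᵢ⟫ in the
empirical norm. Testing the equation of zᵢ with zᵢ bounds both through the effective dimension N =
(1/n) ∑ ⟪gᵢ, S gᵢ⟫, the trace of A(A + α)⁻¹.

It remains to see that N = O(α^(-1/(2m))). If all gᵢ lie within √ρ of a subspace V, then N ≤ 2 dim V
+ ρ/α (`effective_dimension_le`). Such a V comes from smoothness: by the closed graph theorem the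
derivatives of Kx depend boundedly on x, so values of derivatives of order below m are bounded
functionals, and order m - 1 is Hölder of exponent 1/2 (`exists_derivative_functionals`). Taylor
expansion about the nearest grid point to the left, on a grid of width δ, then approximates each gᵢ
with ρ of order δ^(2m-1), using m functionals per node (`exists_taylor_subspace`). Taking δ of order
α^(1/(2m)) balances dim V against ρ/α. -/

noncomputable section

namespace FredholmTikhonov

/-! ### Tikhonov regularization of finitely many functionals on a Hilbert space -/

section Regularization

variable {H : Type*} [NormedAddCommGroup H] [InnerProductSpace ℝ H] {n : ℕ}

open scoped InnerProductSpace

/-- The operator `T* T` for the sampling map `T x = (⟪g i, x⟫)ᵢ` into `ℝⁿ` with the empirical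
norm. -/
def normalOp (g : Fin n → H) : H →L[ℝ] H :=
  (1 / (n : ℝ)) • ∑ i, (innerSL ℝ (g i)).smulRight (g i)

theorem normalOp_apply (g : Fin n → H) (x : H) :
    normalOp g x = (1 / (n : ℝ)) • ∑ i, ⟪g i, x⟫_ℝ • g i := by
  simp [normalOp]

theorem inner_normalOp (g : Fin n → H) (x y : H) :
    ⟪normalOp g x, y⟫_ℝ = (1 / (n : ℝ)) * ∑ i, ⟪g i, x⟫_ℝ * ⟪g i, y⟫_ℝ := by
  simp [normalOp_apply, inner_smul_left, sum_inner]

theorem inner_normalOp_comm (g : Fin n → H) (x y : H) :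
    ⟪normalOp g x, y⟫_ℝ = ⟪x, normalOp g y⟫_ℝ := by
  rw [real_inner_comm _ x, inner_normalOp, inner_normalOp]
  simp only [mul_comm]

theorem inner_normalOp_self_nonneg (g : Fin n → H) (x : H) : 0 ≤ ⟪normalOp g x, x⟫_ℝ := by
  rw [inner_normalOp]
  exact mul_nonneg (by positivity) (Finset.sum_nonneg fun i _ => mul_self_nonneg _)

theorem empNorm_sq (v : Fin n → ℝ) : empNorm v ^ 2 = (1 / (n : ℝ)) * ∑ i, v i ^ 2 :=
  Real.sq_sqrt (mul_nonneg (by positivity) (Finset.sum_nonneg fun i _ => sq_nonneg _))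

/-- Lax–Milgram: since A ≥ 0, the form of A + α is coercive with constant α. -/
theorem exists_regularized_inverse [CompleteSpace H] (g : Fin n → H) {α : ℝ} (hα : 0 < α) :
    ∃ S : H →ₗ[ℝ] H, ∀ v, normalOp g (S v) + α • S v = v := by
  have hB : IsCoercive ((innerSL ℝ).comp (normalOp g + α • ContinuousLinearMap.id ℝ H)) := by
    refine ⟨α, hα, fun u => ?_⟩
    have := inner_normalOp_self_nonneg g u
    simp only [ContinuousLinearMap.comp_apply, innerSL_apply_apply, add_apply,
      smul_apply, ContinuousLinearMap.id_apply, inner_add_left,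
      inner_smul_left, real_inner_self_eq_norm_sq, conj_trivial]
    nlinarith
  refine ⟨hB.continuousLinearEquivOfBilin.symm.toLinearEquiv.toLinearMap, fun v => ?_⟩
  refine ext_inner_right ℝ fun w => ?_
  have := hB.continuousLinearEquivOfBilin_apply (hB.continuousLinearEquivOfBilin.symm v) w
  rw [ContinuousLinearEquiv.apply_symm_apply] at this
  exact this.symm

variable {g : Fin n → H} {α : ℝ}

/-- Energy identity for the regularized normal equation. -/
theorem inner_eq_of_normal_eq {u v : H} (h : normalOp g u + α • u = v) :
    ⟪v, u⟫_ℝ = ⟪normalOp g u, u⟫_ℝ + α * ‖u‖ ^ 2 := by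
  rw [← h, inner_add_left, inner_smul_left, real_inner_self_eq_norm_sq, conj_trivial]

theorem norm_sq_of_normal_eq {u v : H} (h : normalOp g u + α • u = v) :
    ‖v‖ ^ 2 = ‖normalOp g u‖ ^ 2 + 2 * α * ⟪normalOp g u, u⟫_ℝ + α ^ 2 * ‖u‖ ^ 2 := by
  rw [← h, norm_add_sq_real, inner_smul_right, norm_smul, mul_pow, Real.norm_eq_abs, sq_abs]
  ring

/-- This and the next lemma are the operator bounds (A + α)⁻¹ ≤ 1/α and A(A + α)⁻¹ ≤ 1. Both follow
by expanding ‖A u + α u‖² and dropping nonnegative terms, without spectral calculus. -/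
theorem inner_le_norm_sq_div {u v : H} (hα : 0 < α) (h : normalOp g u + α • u = v) :
    ⟪v, u⟫_ℝ ≤ ‖v‖ ^ 2 / α := by
  rw [le_div_iff₀ hα, inner_eq_of_normal_eq h, norm_sq_of_normal_eq h]
  have := mul_nonneg hα.le (inner_normalOp_self_nonneg g u)
  nlinarith [sq_nonneg ‖normalOp g u‖]

theorem inner_normalOp_le_norm_sq {u v : H} (hα : 0 < α) (h : normalOp g u + α • u = v) :
    ⟪normalOp g u, v⟫_ℝ ≤ ‖v‖ ^ 2 := by
  have h1 : ⟪normalOp g u, v⟫_ℝ = ‖normalOp g u‖ ^ 2 + α * ⟪normalOp g u, u⟫_ℝ := by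
    rw [← real_inner_self_eq_norm_sq, ← inner_smul_right, ← inner_add_right, h]
  rw [h1, norm_sq_of_normal_eq h]
  have := mul_nonneg hα.le (inner_normalOp_self_nonneg g u)
  nlinarith [sq_nonneg (α * ‖u‖)]

/-- Pairing the equation with u gives α‖u‖² ≤ α⟪v, u⟫. With v = -x† this and the next lemma are the
two bias bounds. -/
theorem norm_le_of_normal_eq {u v : H} (hα : 0 < α) (h : normalOp g u + α • u = α • v) :
    ‖u‖ ≤ ‖v‖ := by
  have h1 := inner_eq_of_normal_eq h
  rw [inner_smul_left, conj_trivial] at h1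
  have h2 := real_inner_le_norm v u
  have h3 := inner_normalOp_self_nonneg g u
  have h4 : ‖u‖ * ‖u‖ ≤ ‖v‖ * ‖u‖ := by
    refine le_of_mul_le_mul_left ?_ hα
    nlinarith
  by_contra! hlt
  nlinarith [norm_nonneg v]

theorem inner_normalOp_le_of_normal_eq {u v : H} (hα : 0 < α)
    (h : normalOp g u + α • u = α • v) : ⟪normalOp g u, u⟫_ℝ ≤ α * ‖v‖ ^ 2 := by
  have h1 := inner_eq_of_normal_eq h
  rw [inner_smul_left, conj_trivial] at h1
  have h2 := real_inner_le_norm v u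
  have h3 := norm_le_of_normal_eq hα h
  have h4 : ⟪v, u⟫_ℝ ≤ ‖v‖ ^ 2 := by nlinarith [norm_nonneg v]
  nlinarith [mul_le_mul_of_nonneg_left h4 hα.le, mul_nonneg hα.le (sq_nonneg ‖u‖)]

/-- The effective dimension of the regularized sampling problem is controlled by the distance of
the sampling functionals to a finite-dimensional subspace. -/
theorem effective_dimension_le (hα : 0 < α) {S : H →ₗ[ℝ] H}
    (hS : ∀ v, normalOp g (S v) + α • S v = v) (V : Submodule ℝ H) [FiniteDimensional ℝ V]
    {ρ : ℝ} (hρ : 0 ≤ ρ) (hV : ∀ i, ∃ p ∈ V, ‖g i - p‖ ^ 2 ≤ ρ) :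
    (1 / (n : ℝ)) * ∑ i, ⟪g i, S (g i)⟫_ℝ ≤ 2 * Module.finrank ℝ V + ρ / α := by
  have hsymm (u v : H) : ⟪S u, v⟫_ℝ = ⟪u, S v⟫_ℝ := by
    conv_lhs => rw [← hS v]
    conv_rhs => rw [← hS u]
    rw [inner_add_left, inner_add_right, inner_normalOp_comm, inner_smul_left, inner_smul_right,
      conj_trivial]
  set N : ℝ := (1 / (n : ℝ)) * ∑ i, ⟪g i, S (g i)⟫_ℝ with hN
  let v := stdOrthonormalBasis ℝ V
  let p : Fin n → H := fun i => V.starProjection (g i)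
  have hp (i : Fin n) : p i = ∑ l, ⟪(v l : H), g i⟫_ℝ • (v l : H) := by
    simp [p, v.starProjection_eq_sum_rankOne]
  have hr (i : Fin n) : ‖g i - p i‖ ^ 2 ≤ ρ := by
    obtain ⟨q, hq, hle⟩ := hV i
    refine le_trans (pow_le_pow_left₀ (norm_nonneg _) ?_ 2) hle
    rw [Submodule.starProjection_minimal]
    exact ciInf_le ⟨0, by rintro _ ⟨x, rfl⟩; positivity⟩ (⟨q, hq⟩ : V)
  have hsplit : N = (1 / (n : ℝ)) * ∑ i, ⟪p i, S (g i)⟫_ℝ +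
      (1 / (n : ℝ)) * ∑ i, ⟪g i - p i, S (g i)⟫_ℝ := by
    rw [hN, ← mul_add, ← Finset.sum_add_distrib]
    congr 1
    refine Finset.sum_congr rfl fun i _ => ?_
    rw [← inner_add_left, add_sub_cancel]
  -- The part inside V is the trace of A(A + α)⁻¹ over an orthonormal basis of V, each term being at
  -- most 1.
  have hfirst : (1 / (n : ℝ)) * ∑ i, ⟪p i, S (g i)⟫_ℝ ≤ Module.finrank ℝ V := by
    have h1 : (1 / (n : ℝ)) * ∑ i, ⟪p i, S (g i)⟫_ℝ =
        ∑ l, ⟪normalOp g (S (v l)), (v l : H)⟫_ℝ := by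
      simp_rw [inner_normalOp, hp, sum_inner, inner_smul_left, conj_trivial]
      rw [Finset.sum_comm, Finset.mul_sum]
      refine Finset.sum_congr rfl fun l _ => ?_
      congr 1
      refine Finset.sum_congr rfl fun i _ => ?_
      rw [← hsymm, real_inner_comm (v l : H) (g i), real_inner_comm (S (v l)) (g i)]
      ring
    rw [h1]
    calc _ ≤ ∑ l : Fin (Module.finrank ℝ V), (1 : ℝ) := by
          refine Finset.sum_le_sum fun l _ => ?_
          refine (inner_normalOp_le_norm_sq hα (hS (v l))).trans ?_
          have : ‖(v l : H)‖ = 1 := v.orthonormal.1 l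
          rw [this]; norm_num
      _ = _ := by simp
  have hsecond : (1 / (n : ℝ)) * ∑ i, ⟪g i - p i, S (g i)⟫_ℝ ≤ ρ / (2 * α) + N / 2 := by
    have key (i : Fin n) : ⟪g i - p i, S (g i)⟫_ℝ ≤ ρ / (2 * α) + ⟪g i, S (g i)⟫_ℝ / 2 := by
      set r := g i - p i
      -- S is positive, so the cross term obeys 2⟪r, S g⟫ ≤ ⟪g, S g⟫ + ⟪r, S r⟫. Half of N is
      -- absorbed at the end, hence the factor 2 in the bound.
      have h0 : 0 ≤ ⟪g i - r, S (g i - r)⟫_ℝ := by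
        rw [inner_eq_of_normal_eq (hS (g i - r))]
        have := inner_normalOp_self_nonneg g (S (g i - r))
        positivity
      rw [map_sub, inner_sub_left, inner_sub_right, inner_sub_right,
        ← hsymm (g i) r, real_inner_comm r (S (g i))] at h0
      have h1 := inner_le_norm_sq_div hα (hS r)
      have h2 : ‖r‖ ^ 2 / α ≤ ρ / α := by gcongr; exact hr i
      have h3 : ρ / (2 * α) = ρ / α / 2 := by field_simp
      linarith
    -- Stated as an inequality, which also covers n = 0.
    have hc : (1 / (n : ℝ)) * ∑ _i : Fin n, ρ / (2 * α) ≤ ρ / (2 * α) := by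
      rw [Finset.sum_const, Finset.card_univ, Fintype.card_fin, nsmul_eq_mul, ← mul_assoc]
      refine mul_le_of_le_one_left (by positivity) ?_
      rw [one_div]
      exact inv_mul_le_one
    calc _ ≤ (1 / (n : ℝ)) * ∑ i, (ρ / (2 * α) + ⟪g i, S (g i)⟫_ℝ / 2) := by
          gcongr with i; exact key i
      _ = (1 / (n : ℝ)) * ∑ _i : Fin n, ρ / (2 * α) + N / 2 := by
          rw [Finset.sum_add_distrib, mul_add, hN, ← Finset.sum_div _ _ (2 : ℝ), mul_div_assoc]
      _ ≤ _ := by gcongr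
  have h3 : ρ / (2 * α) = ρ / α / 2 := by field_simp
  linarith

/-- The Tikhonov functional exceeds its value at a solution of the normal equation by the energy
of the difference. -/
theorem tikhonov_expansion {w : Fin n → ℝ} {x : H}
    (hx : normalOp g x + α • x = (1 / (n : ℝ)) • ∑ i, w i • g i) (z : H) :
    empNorm ((fun i => ⟪g i, z⟫_ℝ) - w) ^ 2 + α * ‖z‖ ^ 2 =
      empNorm ((fun i => ⟪g i, x⟫_ℝ) - w) ^ 2 + α * ‖x‖ ^ 2 +
        (⟪normalOp g (z - x), z - x⟫_ℝ + α * ‖z - x‖ ^ 2) := by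
  have key : ⟪normalOp g x + α • x, z - x⟫_ℝ =
      (1 / (n : ℝ)) * ∑ i, w i * ⟪g i, z - x⟫_ℝ := by
    rw [hx]; simp [inner_smul_left, sum_inner]
  rw [inner_add_left, inner_normalOp, inner_smul_left, conj_trivial] at key
  have hz : ‖z‖ ^ 2 = ‖x‖ ^ 2 + 2 * ⟪x, z - x⟫_ℝ + ‖z - x‖ ^ 2 := by
    rw [← norm_add_sq_real, add_sub_cancel]
  have hs : ∑ i, (⟪g i, z⟫_ℝ - w i) ^ 2 = ∑ i, (⟪g i, x⟫_ℝ - w i) ^ 2 +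
      2 * (∑ i, ⟪g i, x⟫_ℝ * ⟪g i, z - x⟫_ℝ - ∑ i, w i * ⟪g i, z - x⟫_ℝ) +
      ∑ i, ⟪g i, z - x⟫_ℝ * ⟪g i, z - x⟫_ℝ := by
    rw [← Finset.sum_sub_distrib, Finset.mul_sum, ← Finset.sum_add_distrib,
      ← Finset.sum_add_distrib]
    refine Finset.sum_congr rfl fun i _ => ?_
    rw [inner_sub_right]; ring
  rw [empNorm_sq, empNorm_sq, inner_normalOp]
  simp only [Pi.sub_apply]
  rw [hs, hz]
  linear_combination 2 * key

/-- Second moment of a linear combination of independent centred random variables. -/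
theorem integral_norm_sum_smul_sq_le {Ω : Type*} [MeasurableSpace Ω] {P : Measure Ω}
    [IsProbabilityMeasure P] {σ : ℝ} {e : Fin n → Ω → ℝ} (he : ∀ i, MemLp (e i) 2 P)
    (hind : iIndepFun e P) (hmean : ∀ i, ∫ ω, e i ω ∂P = 0)
    (hvar : ∀ i, variance (e i) P ≤ σ ^ 2) (z : Fin n → H) :
    Integrable (fun ω => ‖∑ i, e i ω • z i‖ ^ 2) P ∧
      ∫ ω, ‖∑ i, e i ω • z i‖ ^ 2 ∂P ≤ σ ^ 2 * ∑ i, ‖z i‖ ^ 2 := by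
  have hexp (ω : Ω) : ‖∑ i, e i ω • z i‖ ^ 2 =
      ∑ i, ∑ j, (e i ω * e j ω) * ⟪z i, z j⟫_ℝ := by
    rw [← real_inner_self_eq_norm_sq, sum_inner]
    refine Finset.sum_congr rfl fun i _ => ?_
    rw [inner_sum]
    refine Finset.sum_congr rfl fun j _ => ?_
    rw [inner_smul_left, inner_smul_right, conj_trivial]; ring
  have hint (i j : Fin n) : Integrable (fun ω => e i ω * e j ω) P :=
    (he i).integrable_mul (he j)
  have hint2 (i j : Fin n) : Integrable (fun ω => (e i ω * e j ω) * ⟪z i, z j⟫_ℝ) P :=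
    (hint i j).mul_const _
  simp_rw [hexp]
  refine ⟨integrable_finsetSum _ fun i _ => integrable_finsetSum _ fun j _ => hint2 i j, ?_⟩
  rw [integral_finsetSum _ fun i _ => integrable_finsetSum _ fun j _ => hint2 i j,
    Finset.mul_sum]
  refine Finset.sum_le_sum fun i _ => ?_
  rw [integral_finsetSum _ fun j _ => hint2 i j, Finset.sum_eq_single i]
  · rw [integral_mul_const, real_inner_self_eq_norm_sq]
    refine mul_le_mul_of_nonneg_right ?_ (sq_nonneg _)
    refine le_trans (le_of_eq ?_) (hvar i)
    rw [variance_of_integral_eq_zero (he i).aemeasurable (hmean i)]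
    simp only [sq]
  -- Off the diagonal, independence factors the expectation into a product of zero means.
  · intro j _ hji
    rw [integral_mul_const, (hind.indepFun hji.symm).integral_fun_mul_eq_mul_integral
      (he i).1 (he j).1, hmean i]
    simp
  · simp

end Regularization

/-! ### Weak derivatives, bounded dependence on the argument, and primitives -/

section Sobolev

open Filter Topology
open scoped InnerProductSpace

variable {a b : ℝ}

theorem L2.integrable (u : L2 a b) : Integrable u (lebesgue a b) :=
  (Lp.memLp u).integrable (by norm_num)

/-- Sections of the kernel act as bounded functionals for almost every point. -/
theorem ae_exists_integral_kernel_eq_inner (k : L2Kernel a b) :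
    ∀ᵐ s ∂(lebesgue a b), ∃ κ : L2 a b, ∀ x : L2 a b,
      ∫ t, k (s, t) * x t ∂(lebesgue a b) = ⟪κ, x⟫_ℝ := by
  have hk := Lp.memLp k
  filter_upwards [hk.1.prodMk_left, hk.integrable_sq.prod_right_ae] with s hs hs2
  have hm : MemLp (fun t => k (s, t)) 2 (lebesgue a b) :=
    (memLp_two_iff_integrable_sq hs).2 hs2
  refine ⟨hm.toLp, fun x => ?_⟩
  rw [L2.inner_def]
  refine integral_congr_ae ?_
  filter_upwards [hm.coeFn_toLp] with t ht
  rw [ht]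
  simp [mul_comm]

theorem integralOp_ae (k : L2Kernel a b) (x : L2 a b) :
    integralOp k x =ᵐ[lebesgue a b] fun s => ∫ t, k (s, t) * x t ∂(lebesgue a b) :=
  (memLp_integral_kernel k x).coeFn_toLp

/-- The integral operator as a linear map. -/
def integralOpLinear (k : L2Kernel a b) : L2 a b →ₗ[ℝ] L2 a b where
  toFun := integralOp k
  map_add' x y := by
    refine Lp.ext ?_
    filter_upwards [integralOp_ae k (x + y), integralOp_ae k x, integralOp_ae k y,
      Lp.coeFn_add (integralOp k x) (integralOp k y),
      ae_exists_integral_kernel_eq_inner k] with s h1 h2 h3 h4 ⟨κ, hκ⟩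
    rw [h1, h4, Pi.add_apply, h2, h3, hκ, hκ, hκ, inner_add_right]
  map_smul' c x := by
    refine Lp.ext ?_
    filter_upwards [integralOp_ae k (c • x), integralOp_ae k x,
      Lp.coeFn_smul c (integralOp k x),
      ae_exists_integral_kernel_eq_inner k] with s h1 h2 h3 ⟨κ, hκ⟩
    rw [h1, RingHom.id_apply, h3, Pi.smul_apply, h2, hκ, hκ, inner_smul_right, smul_eq_mul]

/-- Closed graph: along an a.e. convergent subsequence of the images, the limit is identified
pointwise, because almost every section of the kernel is a bounded functional. -/
theorem continuous_integralOp (k : L2Kernel a b) : Continuous (integralOp k) := by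
  refine (integralOpLinear k).continuous_of_seq_closed_graph fun u x y hu hy => ?_
  obtain ⟨ns, hns, hae⟩ := (tendstoInMeasure_of_tendsto_Lp hy).exists_seq_tendsto_ae
  refine Lp.ext ?_
  have hall : ∀ᵐ s ∂(lebesgue a b), ∀ i, integralOp k (u i) s =
      ∫ t, k (s, t) * u i t ∂(lebesgue a b) := ae_all_iff.2 fun i => integralOp_ae k (u i)
  filter_upwards [hae, hall, integralOp_ae k x, ae_exists_integral_kernel_eq_inner k]
    with s h1 h2 h3 ⟨κ, hκ⟩
  refine tendsto_nhds_unique h1 ?_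
  have h4 : Tendsto (fun i => ⟪κ, u (ns i)⟫_ℝ) atTop (𝓝 ⟪κ, x⟫_ℝ) :=
    ((innerSL ℝ κ).continuous.tendsto x).comp (hu.comp hns.tendsto_atTop)
  change Tendsto (fun i => integralOp k (u (ns i)) s) atTop (𝓝 (integralOp k x s))
  rw [h3, hκ]
  simpa only [h2, hκ] using h4

/-- Integration against a continuous function is a bounded functional on `L²(a, b)`. -/
theorem exists_integral_mul_eq_inner {φ : ℝ → ℝ} (hφ : Continuous φ) :
    ∃ Φ : L2 a b, ∀ u : L2 a b, ∫ t, u t * φ t ∂(lebesgue a b) = ⟪Φ, u⟫_ℝ := by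
  obtain ⟨C, hC⟩ := isCompact_Icc.exists_bound_of_continuousOn (hφ.continuousOn (s := Icc a b))
  have hm : MemLp φ 2 (lebesgue a b) :=
    MemLp.of_bound hφ.aestronglyMeasurable C
      ((ae_restrict_iff' measurableSet_Ioo).2
        (ae_of_all _ fun t ht => hC t (Ioo_subset_Icc_self ht)))
  refine ⟨hm.toLp, fun u => ?_⟩
  rw [L2.inner_def]
  refine integral_congr_ae ?_
  filter_upwards [hm.coeFn_toLp] with t ht
  rw [ht]
  simp

theorem integrable_of_continuous {φ : ℝ → ℝ} (hφ : Continuous φ) :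
    Integrable φ (lebesgue a b) :=
  (hφ.integrableOn_Icc (a := a) (b := b)).mono_set Ioo_subset_Icc_self

theorem ae_eq_zero_of_forall_test {f : ℝ → ℝ} (hf : Integrable f (lebesgue a b))
    (h : ∀ φ : ℝ → ℝ, ContDiff ℝ (⊤ : ℕ∞) φ → HasCompactSupport φ → tsupport φ ⊆ Ioo a b →
      ∫ t, f t * φ t ∂(lebesgue a b) = 0) : f =ᵐ[lebesgue a b] 0 := by
  refine (ae_restrict_iff' measurableSet_Ioo).2 ?_
  refine isOpen_Ioo.ae_eq_zero_of_integral_contDiff_smul_eq_zero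
    (IntegrableOn.locallyIntegrableOn hf) fun φ h1 h2 h3 => ?_
  rw [← h φ h1 h2 h3, ← setIntegral_eq_integral_of_forall_compl_eq_zero (s := Ioo a b)]
  · simp only [smul_eq_mul, mul_comm]
  · intro t ht
    rw [image_eq_zero_of_notMem_tsupport fun h => ht (h3 h), zero_smul]

theorem HasWeakDeriv.unique {j : ℕ} {f g g' : L2 a b} (h : HasWeakDeriv j f g)
    (h' : HasWeakDeriv j f g') : g = g' := by
  refine Lp.ext ?_
  have h0 : (fun t => g t - g' t) =ᵐ[lebesgue a b] 0 := by
    refine ae_eq_zero_of_forall_test (g.integrable.sub g'.integrable) fun φ h1 h2 h3 => ?_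
    obtain ⟨Φ, hΦ⟩ := exists_integral_mul_eq_inner (a := a) (b := b) h1.continuous
    have e : ∫ t, (g t - g' t) * φ t ∂(lebesgue a b) =
        ∫ t, (g - g') t * φ t ∂(lebesgue a b) := by
      refine integral_congr_ae ?_
      filter_upwards [Lp.coeFn_sub g g'] with t ht
      rw [ht, Pi.sub_apply]
    rw [e, hΦ, inner_sub_right, ← hΦ, ← hΦ, h φ h1 h2 h3, h' φ h1 h2 h3, sub_self]
  filter_upwards [h0] with t ht
  exact sub_eq_zero.1 ht

theorem HasWeakDeriv.of_linear {j : ℕ} {f g f' g' : L2 a b} (h : HasWeakDeriv j f g)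
    (h' : HasWeakDeriv j f' g') (c : ℝ) : HasWeakDeriv j (c • f + f') (c • g + g') := by
  intro φ h1 h2 h3
  obtain ⟨Φ, hΦ⟩ := exists_integral_mul_eq_inner (a := a) (b := b) h1.continuous
  obtain ⟨Ψ, hΨ⟩ := exists_integral_mul_eq_inner (a := a) (b := b)
    (h1.continuous_iteratedDeriv j (by exact_mod_cast le_top))
  have e := h φ h1 h2 h3
  have e' := h' φ h1 h2 h3
  rw [hΦ, hΨ] at e e' ⊢
  rw [inner_add_right, inner_add_right, inner_smul_right, inner_smul_right, e, e']
  ring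

/-- If all functions in the range of `K` have a weak derivative of order `j`, then these depend
boundedly on the argument. -/
theorem exists_weakDeriv_clm (k : L2Kernel a b) (j : ℕ)
    (hK : ∀ x : L2 a b, ∃ g, HasWeakDeriv j (integralOp k x) g) :
    ∃ D : L2 a b →L[ℝ] L2 a b, ∀ x, HasWeakDeriv j (integralOp k x) (D x) := by
  choose D hD using hK
  -- Uniqueness of weak derivatives makes the chosen map linear.
  have hlin (c : ℝ) (x y : L2 a b) : D (c • x + y) = c • D x + D y := by
    refine (hD _).unique ?_
    have e : integralOp k (c • x + y) = c • integralOp k x + integralOp k y := by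
      change integralOpLinear k (c • x + y) = _
      rw [map_add, map_smul]; rfl
    rw [e]
    exact (hD x).of_linear (hD y) c
  let D' : L2 a b →ₗ[ℝ] L2 a b := IsLinearMap.mk' D
    { map_add := fun x y => by simpa using hlin 1 x y
      map_smul := fun c x => by
        have h0 : D 0 = 0 := by simpa using hlin (-1) 0 0
        simpa [h0] using hlin c x 0 }
  -- For a fixed test function both sides of the weak derivative identity are continuous
  -- functionals, so the identity passes to the limit and the graph is closed.
  refine ⟨⟨D', D'.continuous_of_seq_closed_graph fun u x y hu hy => ?_⟩, hD⟩
  refine HasWeakDeriv.unique ?_ (hD x)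
  intro φ h1 h2 h3
  obtain ⟨Φ, hΦ⟩ := exists_integral_mul_eq_inner (a := a) (b := b) h1.continuous
  obtain ⟨Ψ, hΨ⟩ := exists_integral_mul_eq_inner (a := a) (b := b)
    (h1.continuous_iteratedDeriv j (by exact_mod_cast le_top))
  have l1 : Tendsto (fun i => ⟪Φ, D (u i)⟫_ℝ) atTop (𝓝 ⟪Φ, y⟫_ℝ) :=
    ((innerSL ℝ Φ).continuous.tendsto y).comp hy
  have l2 : Tendsto (fun i => (-1) ^ j * ⟪Ψ, integralOp k (u i)⟫_ℝ) atTop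
      (𝓝 ((-1) ^ j * ⟪Ψ, integralOp k x⟫_ℝ)) :=
    ((((innerSL ℝ Ψ).continuous.comp (continuous_integralOp k)).tendsto x).comp hu).const_mul _
  rw [hΦ, hΨ]
  refine tendsto_nhds_unique l1 (l2.congr fun i => ?_)
  rw [← hΦ, ← hΨ, hD (u i) φ h1 h2 h3]

/-- The order-j identity is tested with φ'. This reduces higher orders to the first-order
representation formula. -/
theorem HasWeakDeriv.succ {j : ℕ} {f g g' : L2 a b} (h : HasWeakDeriv j f g)
    (h' : HasWeakDeriv (j + 1) f g') : HasWeakDeriv 1 g g' := by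
  intro φ h1 h2 h3
  rw [h' φ h1 h2 h3, iteratedDeriv_one, h (deriv φ) (contDiff_infty_iff_deriv.1 h1).2 h2.deriv
    (tsupport_deriv_subset.trans h3), iteratedDeriv_succ', pow_succ]
  ring

/-- The primitive `∫ₐˢ u` as a bounded functional of `u ∈ L²(a, b)`. -/
def primitive (a b s : ℝ) : L2 a b →L[ℝ] ℝ :=
  innerSL ℝ (indicatorConstLp 2 (measurableSet_Ioc : MeasurableSet (Ioc a s))
    (measure_ne_top (lebesgue a b) _) (1 : ℝ))

theorem primitive_apply (s : ℝ) (u : L2 a b) :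
    primitive a b s u = ∫ t in Ioc a s, u t ∂(lebesgue a b) := by
  rw [primitive, innerSL_apply_apply, L2.inner_indicatorConstLp_one]

/-- Cauchy–Schwarz against the indicator of (t, s], whose norm is at most √(s - t). This is the
source of the Hölder exponent 1/2. -/
theorem abs_primitive_sub_le {t s : ℝ} (hat : a ≤ t) (hts : t ≤ s) (u : L2 a b) :
    |primitive a b s u - primitive a b t u| ≤ √(s - t) * ‖u‖ := by
  have h1 : primitive a b s u - primitive a b t u = ∫ x in Ioc t s, u x ∂(lebesgue a b) := by
    rw [primitive_apply, primitive_apply, ← Ioc_union_Ioc_eq_Ioc hat hts,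
      setIntegral_union (Ioc_disjoint_Ioc_of_le le_rfl) measurableSet_Ioc
        u.integrable.integrableOn u.integrable.integrableOn, add_sub_cancel_left]
  rw [h1, ← L2.inner_indicatorConstLp_one (𝕜 := ℝ) measurableSet_Ioc
    (measure_ne_top (lebesgue a b) _)]
  refine (abs_real_inner_le_norm _ _).trans ?_
  refine mul_le_mul_of_nonneg_right ?_ (norm_nonneg _)
  rw [norm_indicatorConstLp (by norm_num) (by norm_num), norm_one, one_mul, Real.sqrt_eq_rpow]
  simp only [ENNReal.toReal_ofNat]
  refine Real.rpow_le_rpow measureReal_nonneg ?_ (by norm_num)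
  calc (lebesgue a b).real (Ioc t s) ≤ volume.real (Ioc t s) := by
        refine ENNReal.toReal_mono (by simp) ?_
        exact Measure.restrict_apply_le _ _
    _ = s - t := by simp [Measure.real, hts]

theorem continuousOn_primitive (u : L2 a b) :
    ContinuousOn (fun s => primitive a b s u) (Ici a) := by
  have hb {t s : ℝ} (ht : a ≤ t) (hs : a ≤ s) :
      |primitive a b s u - primitive a b t u| ≤ √|s - t| * ‖u‖ := by
    rcases le_total t s with h | h
    · rw [abs_of_nonneg (sub_nonneg.2 h)]; exact abs_primitive_sub_le ht h u
    · rw [abs_sub_comm, abs_sub_comm s t, abs_of_nonneg (sub_nonneg.2 h)]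
      exact abs_primitive_sub_le hs h u
  intro t ht
  refine tendsto_iff_dist_tendsto_zero.2 ?_
  refine squeeze_zero' (Eventually.of_forall fun _ => dist_nonneg)
    (g := fun s => √|s - t| * ‖u‖) ?_ ?_
  · filter_upwards [self_mem_nhdsWithin] with s hs
    exact hb ht hs
  · have : Continuous fun s => √|s - t| * ‖u‖ := by fun_prop
    have h0 := (this.tendsto t).mono_left (nhdsWithin_le_nhds (s := Ici a))
    simpa using h0

theorem primitive_eq_intervalIntegral {s : ℝ} (hs : s ∈ Icc a b) {u : L2 a b} {f : ℝ → ℝ}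
    (hf : u =ᵐ[lebesgue a b] f) : primitive a b s u = ∫ t in a..s, f t := by
  rw [primitive_apply, intervalIntegral.integral_of_le hs.1,
    integral_congr_ae (ae_restrict_of_ae hf), lebesgue,
    Measure.restrict_restrict measurableSet_Ioc]
  refine setIntegral_congr_set ?_
  have h : (Ioc a s : Set ℝ) =ᵐ[volume] Ioo a s := Ioo_ae_eq_Ioc.symm
  have h2 : (Ioc a s ∩ Ioo a b : Set ℝ) =ᵐ[volume] (Ioo a s ∩ Ioo a b : Set ℝ) :=
    ae_eq_set_inter h (ae_eq_refl _)
  refine h2.trans ?_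
  rw [Ioo_inter_Ioo, max_self, min_eq_left hs.2]
  exact h.symm

theorem hasDerivWithinAt_primitive {s : ℝ} (hs : s ∈ Icc a b) {u : L2 a b} {f : ℝ → ℝ}
    (hf : u =ᵐ[lebesgue a b] f) (hc : ContinuousOn f (Icc a b)) :
    HasDerivWithinAt (fun s => primitive a b s u) (f s) (Icc a b) s := by
  have hab : a ≤ b := hs.1.trans hs.2
  let F : ℝ → ℝ := IccExtend hab ((Icc a b).domRestrict f)
  have hF : Continuous F := hc.domRestrict.Icc_extend'
  have hFf : ∀ t ∈ Icc a b, F t = f t := fun t ht => IccExtend_of_mem _ _ ht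
  have huF : u =ᵐ[lebesgue a b] F := by
    filter_upwards [hf, ae_restrict_mem measurableSet_Ioo] with t h1 h2
    rw [h1, hFf t (Ioo_subset_Icc_self h2)]
  have hd : HasDerivWithinAt (fun s => ∫ t in a..s, F t) (F s) (Icc a b) s :=
    (intervalIntegral.integral_hasDerivAt_right (hF.intervalIntegrable _ _)
      (hF.stronglyMeasurableAtFilter _ _) hF.continuousAt).hasDerivWithinAt
  rw [← hFf s hs]
  exact hd.congr (fun t ht => primitive_eq_intervalIntegral ht huF)
    (primitive_eq_intervalIntegral hs huF)

/-- Fubini on the triangle t ≤ s. -/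
theorem integral_primitive_mul {φ : ℝ → ℝ} (hφ : Continuous φ) (v : L2 a b) :
    ∫ s, primitive a b s v * φ s ∂(lebesgue a b) =
      ∫ t, v t * (∫ s in t..b, φ s) ∂(lebesgue a b) := by
  have hint : Integrable (fun p : ℝ × ℝ => φ p.1 * v p.2)
      ((lebesgue a b).prod (lebesgue a b)) :=
    (integrable_of_continuous hφ).mul_prod v.integrable
  have hset : MeasurableSet {p : ℝ × ℝ | p.2 ≤ p.1} :=
    measurableSet_le measurable_snd measurable_fst
  have hswap := integral_integral_swap (f := fun s t =>
    {p : ℝ × ℝ | p.2 ≤ p.1}.indicator (fun p : ℝ × ℝ => φ p.1 * v p.2) (s, t))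
    (hint.indicator hset)
  have hL (s : ℝ) : ∫ t, {p : ℝ × ℝ | p.2 ≤ p.1}.indicator
      (fun p : ℝ × ℝ => φ p.1 * v p.2) (s, t) ∂(lebesgue a b) = primitive a b s v * φ s := by
    rw [primitive_apply, ← integral_mul_const, ← integral_indicator measurableSet_Ioc]
    refine integral_congr_ae ?_
    filter_upwards [ae_restrict_mem measurableSet_Ioo] with t ht
    by_cases hts : t ≤ s
    · simp [indicator, hts, ht.1, mul_comm]
    · simp [indicator, hts]
  have hR : ∀ t ∈ Ioo a b, ∫ s, {p : ℝ × ℝ | p.2 ≤ p.1}.indicator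
      (fun p : ℝ × ℝ => φ p.1 * v p.2) (s, t) ∂(lebesgue a b) =
        v t * ∫ s in t..b, φ s := by
    intro t ht
    have e (s : ℝ) : {p : ℝ × ℝ | p.2 ≤ p.1}.indicator
        (fun p : ℝ × ℝ => φ p.1 * v p.2) (s, t) =
          v t * (Ici t).indicator φ s := by
      by_cases hts : t ≤ s
      · simp [indicator, hts, mul_comm]
      · simp [indicator, hts]
    simp_rw [e]
    rw [integral_const_mul, integral_indicator measurableSet_Ici,
      Measure.restrict_restrict measurableSet_Ici, intervalIntegral.integral_of_le ht.2.le,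
      integral_Ioc_eq_integral_Ioo, ← integral_Ico_eq_integral_Ioo]
    congr 3
    ext x
    simp only [mem_inter_iff, mem_Ici, mem_Ioo, mem_Ico]
    exact ⟨fun h => ⟨h.1, h.2.2⟩, fun h => ⟨h.1, ht.1.trans_le h.1, h.2⟩⟩
  simp_rw [hL] at hswap
  rw [hswap]
  exact setIntegral_congr_fun measurableSet_Ioo hR

end Sobolev

/-! ### Continuous representatives, derivative functionals and Taylor's formula -/

section SobolevRepresentation

open Filter Topology
open scoped InnerProductSpace

variable {a b : ℝ}

theorem integral_lebesgue_eq (hab : a ≤ b) (φ : ℝ → ℝ) :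
    ∫ t, φ t ∂(lebesgue a b) = ∫ t in a..b, φ t := by
  rw [intervalIntegral.integral_of_le hab, integral_Ioc_eq_integral_Ioo]

/-- Subtracting a multiple of this bump turns any test function into one of mean zero. -/
theorem exists_test_integral_eq_one (hab : a < b) :
    ∃ χ : ℝ → ℝ, ContDiff ℝ (⊤ : ℕ∞) χ ∧ HasCompactSupport χ ∧ tsupport χ ⊆ Ioo a b ∧
      (tsupport χ).Nonempty ∧ ∫ t in a..b, χ t = 1 := by
  let f : ContDiffBump ((a + b) / 2) :=
    ⟨(b - a) / 8, (b - a) / 4, by linarith, by linarith⟩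
  have hs : tsupport (f.normed volume) ⊆ Ioo a b := by
    rw [f.tsupport_normed_eq, Real.closedBall_eq_Icc]
    refine Icc_subset_Ioo ?_ ?_ <;> simp only [f] <;> linarith
  refine ⟨f.normed volume, f.contDiff_normed, f.hasCompactSupport_normed, hs, ?_, ?_⟩
  · rw [f.tsupport_normed_eq]
    exact Metric.nonempty_closedBall.2 f.rOut_pos.le
  · rw [intervalIntegral.integral_of_le hab.le, integral_Ioc_eq_integral_Ioo,
      setIntegral_eq_integral_of_forall_compl_eq_zero, f.integral_normed]
    intro t ht
    exact image_eq_zero_of_notMem_tsupport fun h => ht (hs h)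

/-- A test function on `(a, b)` with vanishing integral is the derivative of a test function. -/
theorem exists_test_deriv_eq {θ : ℝ → ℝ} (h1 : ContDiff ℝ (⊤ : ℕ∞) θ)
    {K : Set ℝ} (hK : IsCompact K) (hne : K.Nonempty) (hKab : K ⊆ Ioo a b)
    (hθ : ∀ t ∉ K, θ t = 0) (h0 : ∫ t in a..b, θ t = 0) :
    ContDiff ℝ (⊤ : ℕ∞) (fun t => ∫ τ in a..t, θ τ) ∧
      HasCompactSupport (fun t => ∫ τ in a..t, θ τ) ∧
      tsupport (fun t => ∫ τ in a..t, θ τ) ⊆ Ioo a b ∧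
      deriv (fun t => ∫ τ in a..t, θ τ) = θ := by
  have hd (t : ℝ) : HasDerivAt (fun t => ∫ τ in a..t, θ τ) (θ t) t :=
    h1.continuous.integral_hasStrictDerivAt a t |>.hasDerivAt
  have hderiv : deriv (fun t => ∫ τ in a..t, θ τ) = θ := funext fun t => (hd t).deriv
  obtain ⟨c, hcK, hc⟩ := hK.exists_isLeast hne
  obtain ⟨d, hdK, hd'⟩ := hK.exists_isGreatest hne
  -- The primitive vanishes to the left of K because θ does, and to the right because the total
  -- integral is zero.
  have hsub : Function.support (fun t => ∫ τ in a..t, θ τ) ⊆ Icc c d := by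
    intro t ht
    by_contra hcd
    refine ht ?_
    rw [mem_Icc, not_and_or, not_le, not_le] at hcd
    rcases hcd with h | h
    · refine intervalIntegral.integral_zero_ae (ae_of_all _ fun τ hτ => hθ τ fun hmem => ?_)
      have h2 := hc hmem
      have h3 : τ ≤ max a t := hτ.2
      have h4 : max a t < c := max_lt (hKab hcK).1 h
      linarith
    · have e : ∫ τ in a..t, θ τ = (∫ τ in a..b, θ τ) + ∫ τ in b..t, θ τ :=
        (intervalIntegral.integral_add_adjacent_intervals
          (h1.continuous.intervalIntegrable _ _) (h1.continuous.intervalIntegrable _ _)).symm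
      simp only
      rw [e, h0, zero_add]
      refine intervalIntegral.integral_zero_ae (ae_of_all _ fun τ hτ => hθ τ fun hmem => ?_)
      have h2 := hd' hmem
      have h3 : min b t < τ := hτ.1
      have h4 : d < min b t := lt_min (hKab hdK).2 h
      linarith
  have hts : tsupport (fun t => ∫ τ in a..t, θ τ) ⊆ Icc c d := closure_minimal hsub isClosed_Icc
  refine ⟨contDiff_infty_iff_deriv.2 ⟨fun t => (hd t).differentiableAt, by rw [hderiv]; exact h1⟩,
    HasCompactSupport.of_support_subset_isCompact isCompact_Icc hsub,
    hts.trans (Icc_subset_Ioo (hKab hcK).1 (hKab hdK).2), hderiv⟩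

/-- A function with a weak derivative in `L²(a, b)` is a primitive of it up to a constant, which
depends boundedly on the function and its derivative. -/
theorem exists_ae_eq_const_add_primitive (hab : a < b) :
    ∃ Φ Ψ : L2 a b, ∀ u v : L2 a b, HasWeakDeriv 1 u v →
      u =ᵐ[lebesgue a b] fun s => (⟪Φ, u⟫_ℝ + ⟪Ψ, v⟫_ℝ) + primitive a b s v := by
  obtain ⟨χ, χ1, χ2, χ3, χ4, χ5⟩ := exists_test_integral_eq_one hab
  have hχi (p q : ℝ) : IntervalIntegrable χ volume p q := χ1.continuous.intervalIntegrable _ _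
  have hXc : Continuous fun t => ∫ s in t..b, χ s := by
    simp_rw [intervalIntegral.integral_symm b]
    exact (intervalIntegral.continuous_primitive hχi b).neg
  obtain ⟨Φ, hΦ⟩ := exists_integral_mul_eq_inner (a := a) (b := b) χ1.continuous
  obtain ⟨Ψ, hΨ⟩ := exists_integral_mul_eq_inner (a := a) (b := b) hXc
  refine ⟨Φ, -Ψ, fun u v huv => ?_⟩
  rw [inner_neg_left, ← hΦ, ← hΨ]
  -- By Fubini c is the mean of u minus the primitive of v, weighted by χ. This form shows it as a
  -- bounded functional of u and v.
  set c : ℝ := ∫ t, u t * χ t ∂(lebesgue a b) +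
    -∫ t, v t * (∫ s in t..b, χ s) ∂(lebesgue a b) with hc
  have hprim : Integrable (fun s => primitive a b s v) (lebesgue a b) :=
    (((continuousOn_primitive v).mono Icc_subset_Ici_self).integrableOn_Icc).mono_set
      Ioo_subset_Icc_self
  have h0 : (fun s => u s - primitive a b s v - c) =ᵐ[lebesgue a b] 0 := by
    refine ae_eq_zero_of_forall_test ((u.integrable.sub hprim).sub (integrable_const c))
      fun φ φ1 φ2 φ3 => ?_
    have hφi (p q : ℝ) : IntervalIntegrable φ volume p q :=
      φ1.continuous.intervalIntegrable _ _
    set I : ℝ := ∫ t in a..b, φ t with hI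
    -- The du Bois-Reymond argument: θ has mean zero, so it is the derivative of a test function,
    -- with which the weak derivative identity can be tested.
    let θ : ℝ → ℝ := fun t => φ t - I * χ t
    have hθ1 : ContDiff ℝ (⊤ : ℕ∞) θ := φ1.sub (contDiff_const.mul χ1)
    have hθI (p q : ℝ) : ∫ t in p..q, θ t = (∫ t in p..q, φ t) - I * ∫ t in p..q, χ t := by
      rw [intervalIntegral.integral_sub (hφi p q) ((hχi p q).const_mul I),
        intervalIntegral.integral_const_mul]
    have hθ0 : ∫ t in a..b, θ t = 0 := by rw [hθI, χ5, mul_one, sub_self]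
    obtain ⟨ψ1, ψ2, ψ3, ψ4⟩ := exists_test_deriv_eq (a := a) (b := b) hθ1
      (φ2.isCompact.union χ2.isCompact) (χ4.mono subset_union_right)
      (union_subset φ3 χ3) (fun t ht => by
        have h1 : φ t = 0 := image_eq_zero_of_notMem_tsupport fun h => ht (Or.inl h)
        have h2 : χ t = 0 := image_eq_zero_of_notMem_tsupport fun h => ht (Or.inr h)
        simp [θ, h1, h2]) hθ0
    have hweak := huv _ ψ1 ψ2 ψ3
    rw [iteratedDeriv_one, ψ4, pow_one, neg_one_mul] at hweak
    have hmulint {f g : ℝ → ℝ} (hf : Integrable f (lebesgue a b)) (hg : Continuous g) :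
        Integrable (fun t => f t * g t) (lebesgue a b) := by
      obtain ⟨C, hC⟩ :=
        isCompact_Icc.exists_bound_of_continuousOn (hg.continuousOn (s := Icc a b))
      exact hf.mul_bdd hg.aestronglyMeasurable (c := C)
        ((ae_restrict_iff' measurableSet_Ioo).2
          (ae_of_all _ fun t ht => hC t (Ioo_subset_Icc_self ht)))
    have e1 : ∫ t, u t * θ t ∂(lebesgue a b) =
        ∫ t, u t * φ t ∂(lebesgue a b) - I * ∫ t, u t * χ t ∂(lebesgue a b) := by
      rw [← integral_const_mul, ← integral_sub (hmulint u.integrable φ1.continuous)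
        ((hmulint u.integrable χ1.continuous).const_mul I)]
      refine integral_congr_ae (ae_of_all _ fun t => ?_)
      simp only [θ]; ring
    have e2 : ∫ s, primitive a b s v * φ s ∂(lebesgue a b) =
        I * ∫ t, v t * (∫ s in t..b, χ s) ∂(lebesgue a b) -
          ∫ t, v t * (∫ τ in a..t, θ τ) ∂(lebesgue a b) := by
      rw [integral_primitive_mul φ1.continuous, ← integral_const_mul,
        ← integral_sub ((hmulint v.integrable hXc).const_mul I)
          (hmulint v.integrable ψ1.continuous)]
      refine integral_congr_ae (ae_of_all _ fun t => ?_)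
      have h1 : (∫ τ in a..t, θ τ) + ∫ τ in t..b, θ τ = 0 := by
        rw [← hθ0]
        exact intervalIntegral.integral_add_adjacent_intervals
          (hθ1.continuous.intervalIntegrable _ _) (hθ1.continuous.intervalIntegrable _ _)
      rw [hθI t b] at h1
      simp only
      linear_combination v t * h1
    have e3 : ∫ s, (u s - primitive a b s v - c) * φ s ∂(lebesgue a b) =
        ∫ t, u t * φ t ∂(lebesgue a b) - ∫ s, primitive a b s v * φ s ∂(lebesgue a b) -
          c * I := by
      have hi : Integrable (fun t => u t * φ t - primitive a b t v * φ t) (lebesgue a b) :=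
        (hmulint u.integrable φ1.continuous).sub (hmulint hprim φ1.continuous)
      rw [hI, ← integral_lebesgue_eq hab.le, ← integral_const_mul,
        ← integral_sub (hmulint u.integrable φ1.continuous) (hmulint hprim φ1.continuous),
        ← integral_sub hi ((integrable_of_continuous φ1.continuous).const_mul c)]
      refine integral_congr_ae (ae_of_all _ fun t => ?_)
      simp only; ring
    rw [e3, e2, hweak, e1, hc]
    ring
  filter_upwards [h0] with s hs
  have : u s - primitive a b s v - c = 0 := hs
  linarith

/-- Functions continuous on [a, b] that agree almost everywhere agree at every point, endpoints
included, so the choice of representative is immaterial. -/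
theorem continuousRep_eq (hab : a < b) {f : L2 a b} {g : ℝ → ℝ} (hg : ContinuousOn g (Icc a b))
    (hfg : f =ᵐ[lebesgue a b] g) {s : ℝ} (hs : s ∈ Icc a b) : continuousRep f s = g s := by
  have h : ∃ g : ℝ → ℝ, ContinuousOn g (Icc a b) ∧ f =ᵐ[lebesgue a b] g := ⟨g, hg, hfg⟩
  rw [continuousRep, dif_pos h]
  refine Measure.eqOn_Icc_of_ae_eq (μ := volume) hab.ne ?_ h.choose_spec.1 hg hs
  rw [← restrict_Ioo_eq_restrict_Icc]
  exact h.choose_spec.2.symm.trans hfg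

/-- The values of `K x` and of its derivatives of order less than `m` are bounded functionals
of `x`, and those of order `m - 1` are Hölder continuous with exponent `1 / 2`. -/
theorem exists_derivative_functionals (hab : a < b) {m : ℕ} (hm : 1 ≤ m) (k : L2Kernel a b)
    (hK : ∀ x : L2 a b, MemSobolev m (integralOp k x)) :
    ∃ (E : ℕ → ℝ → L2 a b →L[ℝ] ℝ) (L : ℝ), 0 ≤ L ∧
      (∀ s ∈ Icc a b, ∀ x, continuousRep (integralOp k x) s = E 0 s x) ∧
      (∀ j, j + 1 < m → ∀ x, ∀ s ∈ Icc a b,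
        HasDerivWithinAt (fun s => E j s x) (E (j + 1) s x) (Icc a b) s) ∧
      (∀ x, ∀ t s, a ≤ t → t ≤ s →
        |E (m - 1) s x - E (m - 1) t x| ≤ L * √(s - t) * ‖x‖) := by
  have hD (j : ℕ) : ∃ D : L2 a b →L[ℝ] L2 a b,
      j ≤ m → ∀ x, HasWeakDeriv j (integralOp k x) (D x) := by
    by_cases hj : j ≤ m
    · obtain ⟨D, h⟩ := exists_weakDeriv_clm k j fun x => hK x j hj
      exact ⟨D, fun _ => h⟩
    · exact ⟨0, fun h => absurd h hj⟩
  choose D hD using hD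
  obtain ⟨Φ, Ψ, hΦΨ⟩ := exists_ae_eq_const_add_primitive hab
  -- E j s is the value at s of the j-th derivative, expressed through the derivative of order j +
  -- 1. It therefore has this meaning only for j < m; `D` is the zero map beyond order m.
  let E : ℕ → ℝ → L2 a b →L[ℝ] ℝ := fun j s =>
    (innerSL ℝ Φ).comp (D j) + (innerSL ℝ Ψ).comp (D (j + 1)) +
      (primitive a b s).comp (D (j + 1))
  have hE (j : ℕ) (s : ℝ) (x : L2 a b) : E j s x =
      (⟪Φ, D j x⟫_ℝ + ⟪Ψ, D (j + 1) x⟫_ℝ) + primitive a b s (D (j + 1) x) := rfl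
  have hae (j : ℕ) (hj : j + 1 ≤ m) (x : L2 a b) :
      D j x =ᵐ[lebesgue a b] fun s => E j s x :=
    hΦΨ _ _ ((hD j (by omega) x).succ (hD (j + 1) hj x))
  have hcont (j : ℕ) (x : L2 a b) : ContinuousOn (fun s => E j s x) (Icc a b) :=
    continuousOn_const.add ((continuousOn_primitive _).mono Icc_subset_Ici_self)
  refine ⟨E, ‖D m‖, norm_nonneg _, fun s hs x => ?_, fun j hj x s hs => ?_,
    fun x t s hat hts => ?_⟩
  · have h0 : D 0 x = integralOp k x := by
      refine (hD 0 (by omega) x).unique fun φ _ _ _ => ?_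
      rw [iteratedDeriv_zero, pow_zero, one_mul]
    exact continuousRep_eq hab (hcont 0 x) (h0 ▸ hae 0 (by omega) x) hs
  · exact (hasDerivWithinAt_primitive hs (hae (j + 1) hj x) (hcont (j + 1) x)).const_add _
  -- The constants cancel, leaving an increment of the primitive of the m-th derivative; hence L =
  -- ‖D m‖.
  · rw [hE, hE, add_sub_add_left_eq_sub]
    refine (abs_primitive_sub_le hat hts _).trans ?_
    rw [Nat.sub_add_cancel hm, mul_comm ‖D m‖, mul_assoc]
    exact mul_le_mul_of_nonneg_left ((D m).le_opNorm x) (Real.sqrt_nonneg _)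

/-- Taylor's formula with a remainder estimate in terms of the oscillation of the highest
derivative. -/
theorem abs_sub_taylor_le {F : ℕ → ℝ → ℝ} {t s₀ A : ℝ} {m : ℕ}
    (hder : ∀ j, j + 1 < m → ∀ s ∈ Icc t s₀,
      HasDerivWithinAt (F j) (F (j + 1) s) (Icc t s₀) s)
    (htop : ∀ s ∈ Icc t s₀, |F (m - 1) s - F (m - 1) t| ≤ A) (r : ℕ) :
    ∀ j, j + (r + 1) = m → ∀ s ∈ Icc t s₀,
      |F j s - ∑ i ∈ Finset.range (r + 1), (s - t) ^ i / (i.factorial : ℝ) * F (j + i) t| ≤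
        A * (s₀ - t) ^ r := by
  induction r with
  | zero =>
    intro j hj s hs
    obtain rfl : j = m - 1 := by omega
    simpa using htop s hs
  | succ r ih =>
    intro j hj s hs
    have hts : t ≤ s₀ := hs.1.trans hs.2
    let R : ℝ → ℝ := fun s =>
      F j s - ∑ i ∈ Finset.range (r + 2), (s - t) ^ i / (i.factorial : ℝ) * F (j + i) t
    -- The derivative of the remainder of F j is the remainder of F (j + 1) with one term fewer, so
    -- the mean value inequality gains one power of s₀ - t.
    let R' : ℝ → ℝ := fun s => F (j + 1) s -
      ∑ i ∈ Finset.range (r + 1), (s - t) ^ i / (i.factorial : ℝ) * F (j + 1 + i) t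
    have hR : ∀ s ∈ Icc t s₀, HasDerivWithinAt R (R' s) (Icc t s₀) s := by
      intro s hs
      refine (hder j (by omega) s hs).sub ?_
      have hsum : HasDerivAt
          (fun s => ∑ i ∈ Finset.range (r + 2), (s - t) ^ i / (i.factorial : ℝ) * F (j + i) t)
          (∑ i ∈ Finset.range (r + 2),
            (i * (s - t) ^ (i - 1) * 1) / (i.factorial : ℝ) * F (j + i) t) s :=
        HasDerivAt.fun_sum fun i _ =>
          ((((hasDerivAt_id s).sub_const t).pow i).div_const _).mul_const _
      convert hsum.hasDerivWithinAt using 1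
      rw [Finset.sum_range_succ' _ (r + 1)]
      simp only [Nat.cast_zero, zero_mul, zero_div, add_zero]
      refine Finset.sum_congr rfl fun i _ => ?_
      rw [Nat.add_sub_cancel, Nat.factorial_succ, add_right_comm j 1 i, ← add_assoc]
      push_cast
      have : (i.factorial : ℝ) ≠ 0 := by positivity
      have h2 : (i : ℝ) + 1 ≠ 0 := by positivity
      field_simp
    have h0 : R t = 0 := by
      simp only [R]
      rw [Finset.sum_eq_single 0]
      · simp
      · intro i _ hi; simp [hi]
      · simp
    have hmv := norm_image_sub_le_of_norm_deriv_le_segment' hR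
      (C := A * (s₀ - t) ^ r) (fun s hs => ih (j + 1) (by omega) s (Ico_subset_Icc_self hs)) s hs
    rw [h0, sub_zero] at hmv
    have hA : 0 ≤ A := (abs_nonneg _).trans (htop s hs)
    calc |R s| ≤ A * (s₀ - t) ^ r * (s - t) := hmv
      _ ≤ A * (s₀ - t) ^ r * (s₀ - t) := by
          have := sub_nonneg.2 hts
          have := hs.2
          gcongr
      _ = _ := by ring

end SobolevRepresentation

/-! ### Effective dimension and bias-variance estimates -/

section ErrorBounds

open scoped InnerProductSpace

/-- Bias-variance estimate for a constant plus a linear combination of independent centred random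
variables. -/
theorem integral_norm_add_sum_smul_sq_le {H : Type*} [NormedAddCommGroup H]
    [InnerProductSpace ℝ H] {n : ℕ} {Ω : Type*} [MeasurableSpace Ω] {P : Measure Ω}
    [IsProbabilityMeasure P] {σ : ℝ} {e : Fin n → Ω → ℝ} (he : ∀ i, MemLp (e i) 2 P)
    (hind : iIndepFun e P) (hmean : ∀ i, ∫ ω, e i ω ∂P = 0)
    (hvar : ∀ i, variance (e i) P ≤ σ ^ 2) (c : H) (z : Fin n → H) :
    Integrable (fun ω => ‖c + ∑ i, e i ω • z i‖ ^ 2) P ∧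
      ∫ ω, ‖c + ∑ i, e i ω • z i‖ ^ 2 ∂P ≤ ‖c‖ ^ 2 + σ ^ 2 * ∑ i, ‖z i‖ ^ 2 := by
  obtain ⟨h1, h2⟩ := integral_norm_sum_smul_sq_le he hind hmean hvar z
  have hexp (ω : Ω) : ‖c + ∑ i, e i ω • z i‖ ^ 2 =
      ‖c‖ ^ 2 + 2 * ∑ i, e i ω * ⟪c, z i⟫_ℝ + ‖∑ i, e i ω • z i‖ ^ 2 := by
    rw [norm_add_sq_real, inner_sum]
    simp only [inner_smul_right]
  have h3 (i : Fin n) : Integrable (fun ω => e i ω * ⟪c, z i⟫_ℝ) P :=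
    ((he i).integrable (by norm_num)).mul_const _
  have h4 : Integrable (fun ω => 2 * ∑ i, e i ω * ⟪c, z i⟫_ℝ) P :=
    (integrable_finsetSum _ fun i _ => h3 i).const_mul 2
  have h5 : Integrable (fun ω => ‖c‖ ^ 2 + 2 * ∑ i, e i ω * ⟪c, z i⟫_ℝ) P :=
    (integrable_const _).add h4
  simp_rw [hexp]
  refine ⟨h5.add h1, ?_⟩
  have h6 : ∫ ω, 2 * ∑ i, e i ω * ⟪c, z i⟫_ℝ ∂P = 0 := by
    rw [integral_const_mul, integral_finsetSum _ fun i _ => h3 i]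
    simp [integral_mul_const, hmean]
  rw [integral_add h5 h1, integral_add (integrable_const _) h4, h6, integral_const]
  simpa using h2

/-- Sampling functionals are approximated by piecewise Taylor polynomials. -/
theorem exists_taylor_subspace {a b : ℝ} (hab : a < b) {m : ℕ} (hm : 1 ≤ m)
    {E : ℕ → ℝ → L2 a b →L[ℝ] ℝ} {L : ℝ} (hL : 0 ≤ L)
    (hder : ∀ j, j + 1 < m → ∀ x, ∀ s ∈ Icc a b,
      HasDerivWithinAt (fun s => E j s x) (E (j + 1) s x) (Icc a b) s)
    (htop : ∀ x, ∀ t s, a ≤ t → t ≤ s →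
      |E (m - 1) s x - E (m - 1) t x| ≤ L * √(s - t) * ‖x‖) {M : ℕ} (hM : 0 < M) :
    ∃ V : Submodule ℝ (L2 a b), FiniteDimensional ℝ V ∧ Module.finrank ℝ V ≤ m * (M + 1) ∧
      ∀ s ∈ Icc a b, ∀ g : L2 a b, (∀ x, ⟪g, x⟫_ℝ = E 0 s x) →
        ∃ p ∈ V, ‖g - p‖ ^ 2 ≤ L ^ 2 * ((b - a) / M) ^ (2 * m - 1) := by
  set δ : ℝ := (b - a) / M with hδdef
  have hM' : (0 : ℝ) < M := by exact_mod_cast hM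
  have hδ : 0 < δ := div_pos (sub_pos.2 hab) hM'
  let f : ℕ → ℝ → L2 a b := fun j t => (InnerProductSpace.toDual ℝ (L2 a b)).symm (E j t)
  have hf (j : ℕ) (t : ℝ) (x : L2 a b) : ⟪f j t, x⟫_ℝ = E j t x :=
    InnerProductSpace.toDual_symm_apply
  -- There are M + 1 nodes because s = b is expanded about the node b itself.
  let ι : Fin m × Fin (M + 1) → L2 a b := fun q => f q.1 (a + (q.2 : ℕ) * δ)
  refine ⟨Submodule.span ℝ (range ι), FiniteDimensional.span_of_finite ℝ (finite_range ι), ?_, ?_⟩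
  · refine (finrank_range_le_card ι).trans_eq ?_
    simp
  intro s hs g hg
  have hq0 : 0 ≤ (s - a) / δ := div_nonneg (sub_nonneg.2 hs.1) hδ.le
  set q : ℕ := ⌊(s - a) / δ⌋₊ with hq
  have hqM : q ≤ M := by
    refine Nat.floor_le_of_le ?_
    rw [div_le_iff₀ hδ, hδdef, mul_div_cancel₀ _ hM'.ne']
    linarith [hs.2]
  set t : ℝ := a + q * δ with ht
  have hat : a ≤ t := le_add_of_nonneg_right (by positivity)
  have hts : t ≤ s := by
    have := (le_div_iff₀ hδ).1 (Nat.floor_le hq0)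
    rw [ht]; linarith
  have hst : s - t ≤ δ := by
    have := (div_lt_iff₀ hδ).1 (Nat.lt_floor_add_one ((s - a) / δ))
    rw [← hq] at this
    rw [ht]; linarith
  have hst0 : 0 ≤ s - t := sub_nonneg.2 hts
  refine ⟨∑ i ∈ Finset.range m, ((s - t) ^ i / (i.factorial : ℝ)) • f i t, ?_, ?_⟩
  · refine Submodule.sum_mem _ fun i hi => Submodule.smul_mem _ _ (Submodule.subset_span ?_)
    exact ⟨(⟨i, Finset.mem_range.1 hi⟩, ⟨q, by omega⟩), rfl⟩
  set r := g - ∑ i ∈ Finset.range m, ((s - t) ^ i / (i.factorial : ℝ)) • f i t with hr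
  have hsub : Icc t s ⊆ Icc a b := Icc_subset_Icc hat hs.2
  obtain ⟨l, rfl⟩ : ∃ l, m = l + 1 := ⟨m - 1, by omega⟩
  have htaylor := abs_sub_taylor_le (F := fun j τ => E j τ r) (t := t) (s₀ := s)
    (A := L * √(s - t) * ‖r‖) (m := l + 1)
    (fun j hj τ hτ => (hder j hj r τ (hsub hτ)).mono hsub)
    (fun τ hτ => (htop r t τ hat hτ.1).trans (by have := hτ.2; gcongr)) l 0 (by omega) s
    (right_mem_Icc.2 hts)
  -- The error r is tested on itself: ‖r‖² is the Taylor remainder of the functionals at x = r,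
  -- which is bounded by a multiple of ‖r‖; one factor ‖r‖ then cancels.
  have hrr : ‖r‖ ^ 2 = E 0 s r -
      ∑ i ∈ Finset.range (l + 1), (s - t) ^ i / (i.factorial : ℝ) * E (0 + i) t r := by
    rw [← real_inner_self_eq_norm_sq]
    conv_lhs => lhs; rw [hr]
    rw [inner_sub_left, hg, sum_inner]
    simp only [inner_smul_left, hf, zero_add, conj_trivial]
  rw [← hrr, abs_of_nonneg (sq_nonneg _)] at htaylor
  have hle : ‖r‖ ≤ L * √(s - t) * (s - t) ^ l := by
    by_contra! hlt
    have h0 : 0 ≤ L * √(s - t) * (s - t) ^ l := by positivity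
    nlinarith
  calc ‖r‖ ^ 2 ≤ (L * √(s - t) * (s - t) ^ l) ^ 2 := by gcongr
    _ = L ^ 2 * (s - t) ^ (2 * (l + 1) - 1) := by
      rw [mul_pow, mul_pow, Real.sq_sqrt hst0, show 2 * (l + 1) - 1 = l * 2 + 1 by omega]
      ring
    _ ≤ _ := by gcongr

/-- The effective dimension of the sampled operator grows at most like `α ^ (-1 / (2 m))`,
uniformly in the sampling points. -/
theorem exists_effective_dimension_le {a b : ℝ} (hab : a < b) {m : ℕ} (hm : 1 ≤ m)
    {E : ℕ → ℝ → L2 a b →L[ℝ] ℝ} {L : ℝ} (hL : 0 ≤ L)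
    (hder : ∀ j, j + 1 < m → ∀ x, ∀ s ∈ Icc a b,
      HasDerivWithinAt (fun s => E j s x) (E (j + 1) s x) (Icc a b) s)
    (htop : ∀ x, ∀ t s, a ≤ t → t ≤ s →
      |E (m - 1) s x - E (m - 1) t x| ≤ L * √(s - t) * ‖x‖) :
    ∃ C : ℝ, 0 < C ∧ ∀ (n : ℕ) (s : Fin n → ℝ) (g : Fin n → L2 a b),
      (∀ i, s i ∈ Icc a b) → (∀ i x, ⟪g i, x⟫_ℝ = E 0 (s i) x) →
      ∀ α : ℝ, 0 < α → α ≤ 1 → ∀ S : L2 a b →ₗ[ℝ] L2 a b,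
        (∀ v, normalOp g (S v) + α • S v = v) →
        (1 / (n : ℝ)) * ∑ i, ⟪g i, S (g i)⟫_ℝ ≤ C * (1 / α ^ (1 / (2 * (m : ℝ)))) := by
  have hba : 0 < b - a := sub_pos.2 hab
  have hm' : (0 : ℝ) < m := by exact_mod_cast hm
  -- With β = α^(-1/(2m)) ≥ 1 and M = ⌈β⌉, M + 1 ≤ 3β. Thus 2 dim V gives 6mβ, and ρ/α gives the
  -- other summand times β because α = γ^(2m).
  refine ⟨6 * m + L ^ 2 * (b - a) ^ (2 * m - 1), by positivity,
    fun n s g hs hg α hα hα1 S hS => ?_⟩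
  set γ : ℝ := α ^ (1 / (2 * (m : ℝ))) with hγ
  have hγ0 : 0 < γ := Real.rpow_pos_of_pos hα _
  have hγ1 : γ ≤ 1 := Real.rpow_le_one hα.le hα1 (by positivity)
  have hγα : γ ^ (2 * m) = α := by
    rw [hγ, ← Real.rpow_natCast, ← Real.rpow_mul hα.le]
    push_cast
    rw [one_div_mul_cancel (by positivity), Real.rpow_one]
  set β : ℝ := 1 / γ with hβ
  have hβ1 : 1 ≤ β := (one_le_div hγ0).2 hγ1
  set M : ℕ := ⌈β⌉₊ with hMdef
  have hβM : β ≤ M := Nat.le_ceil β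
  have hM0 : 0 < M := Nat.ceil_pos.2 (by linarith)
  have hMβ : (M : ℝ) < β + 1 := Nat.ceil_lt_add_one (by linarith)
  obtain ⟨V, hfin, hdim, hV⟩ := exists_taylor_subspace hab hm hL hder htop hM0
  set ρ : ℝ := L ^ 2 * ((b - a) / M) ^ (2 * m - 1) with hρ
  have hbound := effective_dimension_le hα hS V (ρ := ρ) (by positivity)
    fun i => hV (s i) (hs i) (g i) (hg i)
  have hd : (Module.finrank ℝ V : ℝ) ≤ m * (3 * β) := by
    calc (Module.finrank ℝ V : ℝ) ≤ ((m * (M + 1) : ℕ) : ℝ) := by exact_mod_cast hdim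
      _ = m * (M + 1) := by push_cast; ring
      _ ≤ _ := by gcongr; linarith
  have hρα : ρ / α ≤ L ^ 2 * (b - a) ^ (2 * m - 1) * β := by
    have h1 : (b - a) / M ≤ (b - a) * γ := by
      rw [div_le_iff₀ (by exact_mod_cast hM0)]
      have : 1 ≤ γ * M := by
        rw [hβ, div_le_iff₀ hγ0] at hβM
        linarith
      nlinarith
    have h2 : α = γ ^ (2 * m - 1) * γ := by
      rw [← pow_succ, Nat.sub_add_cancel (by omega), hγα]
    calc ρ / α ≤ L ^ 2 * ((b - a) * γ) ^ (2 * m - 1) / α := by rw [hρ]; gcongr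
      _ = _ := by
        rw [h2, hβ, mul_pow]
        field_simp
  calc _ ≤ _ := hbound
    _ ≤ 2 * (m * (3 * β)) + L ^ 2 * (b - a) ^ (2 * m - 1) * β := by gcongr
    _ = _ := by ring

/-- Existence, uniqueness and error estimates for the regularized solution in terms of the
effective dimension. -/
theorem exists_regularized_solution {a b : ℝ} (k : L2Kernel a b) {n : ℕ} {s : Fin n → ℝ}
    {g : Fin n → L2 a b}
    (hg : ∀ x, sample s (integralOp k x) = fun i => ⟪g i, x⟫_ℝ)
    {α : ℝ} (hα : 0 < α) {S : L2 a b →ₗ[ℝ] L2 a b}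
    (hS : ∀ v, normalOp g (S v) + α • S v = v) {N : ℝ}
    (hN : (1 / (n : ℝ)) * ∑ i, ⟪g i, S (g i)⟫_ℝ ≤ N)
    {Ω : Type*} [MeasurableSpace Ω] {P : Measure Ω} [IsProbabilityMeasure P]
    {σ : ℝ} {e : Fin n → Ω → ℝ} (he : ∀ i, MemLp (e i) 2 P) (hind : iIndepFun e P)
    (hmean : ∀ i, ∫ ω, e i ω ∂P = 0) (hvar : ∀ i, variance (e i) P ≤ σ ^ 2) (xdag : L2 a b) :
    ∃ xreg : Ω → L2 a b,
      (∀ ω x, IsRegularizedSolution k s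
        (fun i => sample s (integralOp k xdag) i + e i ω) α x ↔ x = xreg ω) ∧
      Integrable (fun ω => ‖xreg ω - xdag‖ ^ 2) P ∧
      Integrable (fun ω =>
        empNorm (sample s (integralOp k (xreg ω)) - sample s (integralOp k xdag)) ^ 2) P ∧
      ∫ ω, ‖xreg ω - xdag‖ ^ 2 ∂P ≤ ‖xdag‖ ^ 2 + σ ^ 2 * (N / (n * α)) ∧
      ∫ ω, empNorm (sample s (integralOp k (xreg ω)) - sample s (integralOp k xdag)) ^ 2 ∂P ≤
        α * ‖xdag‖ ^ 2 + σ ^ 2 * (N / n) := by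
  let z : Fin n → L2 a b := fun i => S ((1 / (n : ℝ)) • g i)
  let c : L2 a b := S (normalOp g xdag) - xdag
  let w : Ω → Fin n → ℝ := fun ω i => ⟪g i, xdag⟫_ℝ + e i ω
  let xreg : Ω → L2 a b := fun ω => S ((1 / (n : ℝ)) • ∑ i, w ω i • g i)
  have herr (ω : Ω) : xreg ω - xdag = c + ∑ i, e i ω • z i := by
    have h1 : (1 / (n : ℝ)) • ∑ i, w ω i • g i =
        normalOp g xdag + ∑ i, e i ω • (1 / (n : ℝ)) • g i := by
      simp only [w, add_smul, Finset.sum_add_distrib, smul_add, normalOp_apply, Finset.smul_sum]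
      congr 1
      exact Finset.sum_congr rfl fun i _ => smul_comm _ _ _
    simp only [xreg, c, z]
    rw [h1, map_add, map_sum]
    simp only [map_smul]
    abel
  -- The bias solves the regularized equation with right-hand side -α x†.
  have hc : normalOp g c + α • c = α • (-xdag) := by
    simp only [c, map_sub, smul_sub, smul_neg]
    have := hS (normalOp g xdag)
    rw [sub_add_sub_comm, this]
    abel
  have hc1 : ‖c‖ ^ 2 ≤ ‖xdag‖ ^ 2 := by
    have := norm_le_of_normal_eq hα hc
    rw [norm_neg] at this
    gcongr
  have hc2 : ⟪normalOp g c, c⟫_ℝ ≤ α * ‖xdag‖ ^ 2 := by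
    have := inner_normalOp_le_of_normal_eq hα hc
    rwa [norm_neg] at this
  -- Pairing the equation of zᵢ with zᵢ and summing gives the effective dimension divided by n; the
  -- two nonnegative sums on the left are the two variances up to σ².
  have hz : ∑ i, ⟪normalOp g (z i), z i⟫_ℝ + α * ∑ i, ‖z i‖ ^ 2 ≤ N / n := by
    rw [Finset.mul_sum, ← Finset.sum_add_distrib]
    calc _ = ∑ i, (1 / (n : ℝ)) * ((1 / (n : ℝ)) * ⟪g i, S (g i)⟫_ℝ) := by
          refine Finset.sum_congr rfl fun i _ => ?_
          rw [← inner_eq_of_normal_eq (hS ((1 / (n : ℝ)) • g i)), map_smul, inner_smul_left,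
            inner_smul_right, conj_trivial]
      _ = (1 / (n : ℝ)) * ((1 / (n : ℝ)) * ∑ i, ⟪g i, S (g i)⟫_ℝ) := by
          rw [Finset.mul_sum, Finset.mul_sum]
      _ ≤ (1 / (n : ℝ)) * N := by gcongr
      _ = N / n := by ring
  have hz0 : 0 ≤ ∑ i, ⟪normalOp g (z i), z i⟫_ℝ :=
    Finset.sum_nonneg fun i _ => inner_normalOp_self_nonneg g (z i)
  have hz1 : 0 ≤ ∑ i, ‖z i‖ ^ 2 := Finset.sum_nonneg fun i _ => sq_nonneg _
  have hemp (ω : Ω) :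
      empNorm (sample s (integralOp k (xreg ω)) - sample s (integralOp k xdag)) ^ 2 =
        (1 / (n : ℝ)) * ∑ l, ‖⟪g l, c⟫_ℝ + ∑ i, e i ω • ⟪g l, z i⟫_ℝ‖ ^ 2 := by
    rw [hg, hg, empNorm_sq]
    congr 1
    refine Finset.sum_congr rfl fun l _ => ?_
    rw [Pi.sub_apply, ← inner_sub_right, herr, inner_add_right, inner_sum, Real.norm_eq_abs,
      sq_abs]
    simp only [inner_smul_right, smul_eq_mul]
  have hX := integral_norm_add_sum_smul_sq_le he hind hmean hvar c z
  have hY (l : Fin n) := integral_norm_add_sum_smul_sq_le he hind hmean hvar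
    ⟪g l, c⟫_ℝ (fun i => ⟪g l, z i⟫_ℝ)
  refine ⟨xreg, fun ω x => ?_, ?_, ?_, ?_, ?_⟩
  -- The functional exceeds its value at `xreg ω` by at least α times the squared distance, which
  -- gives both minimality and uniqueness.
  · have hexp := tikhonov_expansion (hS ((1 / (n : ℝ)) • ∑ i, w ω i • g i))
    have hT (x : L2 a b) : tikhonov k s (fun i => sample s (integralOp k xdag) i + e i ω) α x =
        empNorm ((fun i => ⟪g i, x⟫_ℝ) - w ω) ^ 2 + α * ‖x‖ ^ 2 := by
      rw [tikhonov, hg, hg]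
    constructor
    · intro hx
      have h1 := hx (xreg ω)
      rw [hT, hT, hexp x] at h1
      have h2 := inner_normalOp_self_nonneg g (x - xreg ω)
      have h3 : α * ‖x - xreg ω‖ ^ 2 ≤ 0 := by linarith
      have h4 : ‖x - xreg ω‖ ^ 2 ≤ 0 := nonpos_of_mul_nonpos_right h3 hα
      exact sub_eq_zero.1 (norm_eq_zero.1 (pow_eq_zero_iff (two_ne_zero) |>.1
        (le_antisymm h4 (sq_nonneg _))))
    · rintro rfl z'
      rw [hT, hT, hexp z']
      have h2 := inner_normalOp_self_nonneg g (z' - xreg ω)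
      have h3 : 0 ≤ α * ‖z' - xreg ω‖ ^ 2 := by positivity
      linarith
  · simpa only [herr] using hX.1
  · simp_rw [hemp]
    exact (integrable_finsetSum _ fun l _ => (hY l).1).const_mul _
  · simp_rw [herr]
    refine hX.2.trans ?_
    have : ∑ i, ‖z i‖ ^ 2 ≤ N / (n * α) := by
      rw [← div_div, le_div_iff₀ hα]
      linarith
    gcongr
  · simp_rw [hemp]
    rw [integral_const_mul, integral_finsetSum _ fun l _ => (hY l).1]
    calc _ ≤ (1 / (n : ℝ)) * ∑ l, (‖⟪g l, c⟫_ℝ‖ ^ 2 + σ ^ 2 * ∑ i, ‖⟪g l, z i⟫_ℝ‖ ^ 2) := by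
          gcongr with l
          exact (hY l).2
      _ = ⟪normalOp g c, c⟫_ℝ + σ ^ 2 * ∑ i, ⟪normalOp g (z i), z i⟫_ℝ := by
          simp only [inner_normalOp, Real.norm_eq_abs, sq_abs]
          rw [Finset.sum_add_distrib, mul_add, ← Finset.mul_sum, ← Finset.mul_sum,
            Finset.sum_comm]
          simp only [sq]
          ring
      _ ≤ α * ‖xdag‖ ^ 2 + σ ^ 2 * (N / n) := by
          have := mul_nonneg hα.le hz1
          gcongr
          linarith

end ErrorBounds

end FredholmTikhonov

end

/-! ### The error estimate for sampled Fredholm equations -/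

open FredholmTikhonov in
theorem mainTheorem1
    (a b : ℝ) (hab : a < b) (m : ℕ) (hm : 1 ≤ m)
    (k : L2Kernel a b) (hK : ∀ x : L2 a b, MemSobolev m (integralOp k x)) (B : ℝ≥0) :
    ∃ α₀ : ℝ, 0 < α₀ ∧ ∃ C : ℝ, 0 < C ∧
      ∀ (n : ℕ) (_ : 1 ≤ n) (s : Fin n → ℝ) (_ : IsQuasiUniform a b B s)
        (Ω : Type*) (_ : MeasurableSpace Ω) (P : Measure Ω) (_ : IsProbabilityMeasure P)
        (σ : ℝ) (e : Fin n → Ω → ℝ) (_ : ∀ i, MemLp (e i) 2 P) (_ : iIndepFun e P)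
        (_ : ∀ i, ∫ ω, e i ω ∂P = 0) (_ : ∀ i, variance (e i) P ≤ σ ^ 2)
        (y xdag : L2 a b) (_ : IsBestApproximateSolution k y xdag)
        (α : ℝ) (_ : 0 < α) (_ : α ≤ α₀),
        -- the regularized solution for the data `wᵢ = (K x†)(sᵢ) + eᵢ` exists and is unique
        ∃ xreg : Ω → L2 a b,
          (∀ ω x, IsRegularizedSolution k s
            (fun i => sample s (integralOp k xdag) i + e i ω) α x ↔ x = xreg ω) ∧
          Integrable (fun ω => ‖xreg ω - xdag‖ ^ 2) P ∧
          Integrable (fun ω =>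
            empNorm (sample s (integralOp k (xreg ω)) - sample s (integralOp k xdag)) ^ 2) P ∧
          ∫ ω, ‖xreg ω - xdag‖ ^ 2 ∂P ≤
            C * ‖xdag‖ ^ 2 + C * σ ^ 2 / (n * α ^ (1 + 1 / (2 * (m : ℝ)))) ∧
          ∫ ω, empNorm (sample s (integralOp k (xreg ω)) - sample s (integralOp k xdag)) ^ 2 ∂P ≤
            C * α * ‖xdag‖ ^ 2 + C * σ ^ 2 / (n * α ^ (1 / (2 * (m : ℝ)))) := by
  obtain ⟨E, L, hL, hrep, hder, htop⟩ := exists_derivative_functionals hab hm k hK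
  obtain ⟨C, hC, hdim⟩ := exists_effective_dimension_le hab hm hL hder htop
  -- α ≤ 1 is what the effective dimension bound requires. In the constant, 1 serves the bias and C
  -- the variance.
  refine ⟨1, one_pos, 1 + C, by positivity, ?_⟩
  intro n _ s hs Ω _ P _ σ e he hind hmean hvar _ xdag _ α hα hα1
  let g : Fin n → L2 a b := fun i => (InnerProductSpace.toDual ℝ (L2 a b)).symm (E 0 (s i))
  have hgE (i : Fin n) (x : L2 a b) : inner ℝ (g i) x = E 0 (s i) x :=
    InnerProductSpace.toDual_symm_apply
  have hg (x : L2 a b) : sample s (integralOp k x) = fun i => inner ℝ (g i) x := by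
    funext i
    rw [sample, hrep (s i) (hs.mem i), hgE]
  obtain ⟨S, hS⟩ := exists_regularized_inverse g hα
  obtain ⟨xreg, h1, h2, h3, h4, h5⟩ := exists_regularized_solution k hg hα hS
    (hdim n s g hs.mem hgE α hα hα1 S hS) he hind hmean hvar xdag
  set γ : ℝ := α ^ (1 / (2 * (m : ℝ))) with hγ
  have hγ0 : 0 < γ := Real.rpow_pos_of_pos hα _
  refine ⟨xreg, h1, h2, h3, h4.trans ?_, h5.trans ?_⟩
  · rw [Real.rpow_add hα, Real.rpow_one, ← hγ]
    have e1 : σ ^ 2 * (C * (1 / γ) / (n * α)) = C * σ ^ 2 / (n * (α * γ)) := by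
      field_simp
    rw [e1]
    gcongr
    · nlinarith [sq_nonneg ‖xdag‖]
    · linarith
  · have e1 : σ ^ 2 * (C * (1 / γ) / n) = C * σ ^ 2 / (n * γ) := by
      field_simp
    rw [e1]
    gcongr
    · nlinarith
    · linarith
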